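/- Fix an integer $N_s\ge 1$, and reals $\mathcal E>0$, $\mathcal N_0>0$, and put $\gamma=\mathcal E/\mathcal N_0$. Consider systems with $K\ge 1$ users and $N=N_sN_h$ chips, the chips being divided into $N_s$ subgroups of $N_h$ contiguous chips, and the channel $\mathbf y=\mathbf S\mathbf b+\mathbf n$, where: - $\mathbf S=[\mathbf s_1,\dots,\mathbf s_K]\in\mathbb R^{N\times K}$ is a random time-hopping matrix: independently for every user and every subgroup, the column $\mathbf s_k$ has exactly one nonzero entry in the subgroup, at a uniformly distributed position, equal to $+1/\sqrt{N_s}$ or $-1/\sqrt{N_s}$ with probability $1/2$ each; - $\mathbf b=(b_1,\dots,b_K)$ has i.i.d. circularly symmetric complex Gaussian entries $b_k\sim\mathcal{CN}(0,\mathcal E)$; - $\mathbf n\in\mathbb C^N$ is circularly symmetric complex Gaussian with mean zero and covariance $\mathcal N_0\mathbf I$; - $\mathbf S$, $\mathbf b$, $\mathbf n$ are independent. Let $\mathsf y_1=\mathbf s_1^{\mathsf T}\mathbf y$ be the output of the single-user matched filter of user $1$ (or of any other user, with the same conclusions), let $\rho_{1k}=\mathbf s_1^{\mathsf T}\mathbf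 s_k$, and let $I(\mathsf y_1;b_1|\mathbf S)$ be the conditional mutual information given $\mathbf S$, in bits. In the large-system limit, i.e. along any sequence of such systems with $N_s$ fixed, $N_h\to\infty$ and $K/N\to\beta\in[0,\infty)$, the quantity $I(\mathsf y_1;b_1|\mathbf S)$ is finite for every system and $$ I(\mathsf y_1;b_1|\mathbf S)\;\longrightarrow\;\sum_{k\ge0}\frac{(N_s^2\beta)^k}{k!}e^{-N_s^2\beta}\log_2\!\Big(1+\frac{\gamma}{1+\frac{k}{N_s^2}\gamma}\Big), $$ where the series converges; hence the mutual information of the system in b/s/Hz satisfies $$ \frac KN\, I(\mathsf y_1;b_1|\mathbf S)\;\longrightarrow\;\beta\sum_{k\ge0}\frac{(N_s^2\beta)^k}{k!}e^{-N_s^2\beta}\log_2\!\Big(1+\frac{\gamma}{1+\frac{k}{N_s^2}\gamma}\Big). $$ Moreover, the interference energy $\sum_{k=2}^K\rho_{1k}^2$ converges in distribution to $X/N_s^2$, where $X$ is a Poisson random variable with mean $N_s^2\beta$. -/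

import Mathlib

open MeasureTheory ProbabilityTheory Filter Topology
open scoped NNReal ENNReal Matrix

noncomputable section

namespace THCDMA

/-- Real matrices carry the product Borel σ-algebra. -/
instance instMeasurableSpaceRealMatrix {m n : Type*} : MeasurableSpace (Matrix m n ℝ) :=
  inferInstanceAs (MeasurableSpace (m → n → ℝ))

/-! ### Information measures -/

/-- Conditional mutual information `I(X ; Y | Z)`, in nats: the expectation over `Z` of the
Kullback-Leibler divergence of the conditional joint law of `(X, Y)` given `Z` from the product
of the conditional laws of `X` and of `Y` given `Z`. -/
def condMutualInfo {Ω 𝓧 𝓨 𝓩 : Type*} [MeasurableSpace Ω]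
    [MeasurableSpace 𝓧] [StandardBorelSpace 𝓧] [Nonempty 𝓧]
    [MeasurableSpace 𝓨] [StandardBorelSpace 𝓨] [Nonempty 𝓨] [MeasurableSpace 𝓩]
    (X : Ω → 𝓧) (Y : Ω → 𝓨) (Z : Ω → 𝓩) (P : Measure Ω) [IsFiniteMeasure P] : ℝ≥0∞ :=
  ∫⁻ z, InformationTheory.klDiv (condDistrib (fun ω => (X ω, Y ω)) Z P z)
    ((condDistrib X Z P z).prod (condDistrib Y Z P z)) ∂(P.map Z)

/-- The circularly symmetric complex Gaussian law with mean `0` and variance `v`: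
independent real and imaginary parts, each of law `N(0, v / 2)`. -/
def circularGaussian (v : ℝ≥0) : Measure ℂ :=
  ((gaussianReal 0 (v / 2)).prod (gaussianReal 0 (v / 2))).map
    (fun p : ℝ × ℝ => (⟨p.1, p.2⟩ : ℂ))

/-! ### Time-hopping spreading -/

/-- The `N = Ns * Nh` chips are split into `Ns` subgroups of `Nh` contiguous chips; subgroup `m`
consists of the chips `m * Nh, …, m * Nh + Nh - 1`. Given for every subgroup a position and a
sign, this is the sequence whose only nonzero entry in subgroup `m` is at the chosen position
and equals `± 1 / √Ns` according to the chosen sign (`true` for `+`). -/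
def thSequence {Ns Nh : ℕ} (c : Fin Ns → Fin Nh × Bool) : Fin (Ns * Nh) → ℝ := fun i =>
  if (c (finProdFinEquiv.symm i).1).1 = (finProdFinEquiv.symm i).2 then
    (if (c (finProdFinEquiv.symm i).1).2 then 1 else -1) / √(Ns : ℝ)
  else 0

/-- The matrix whose `k`-th column is the sequence of user `k`. -/
def thMatrix {Ns Nh K : ℕ} (c : Fin K → Fin Ns → Fin Nh × Bool) :
    Matrix (Fin (Ns * Nh)) (Fin K) ℝ :=
  Matrix.of fun i k => thSequence (c k) i

/-- The law of a random time-hopping matrix: for every user and every subgroup, independently,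
the pulse position is uniform among the `Nh` chips and the sign is uniform. -/
def thMatrixLaw (Ns Nh K : ℕ) : Measure (Matrix (Fin (Ns * Nh)) (Fin K) ℝ) :=
  (Measure.pi fun _ : Fin K => Measure.pi fun _ : Fin Ns =>
    uniformOn (Set.univ : Set (Fin Nh × Bool))).map thMatrix

/-! ### The channel and the matched filters -/

/-- The received vector `y = S b + n`. -/
def received {N K : ℕ} (S : Matrix (Fin N) (Fin K) ℝ) (b : Fin K → ℂ) (n : Fin N → ℂ) :
    Fin N → ℂ :=
  S.map (fun x : ℝ => (x : ℂ)) *ᵥ b + n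

/-- The output `s_uᵀ y` of the matched filter of user `u`. -/
def matchedFilter {N K : ℕ} (S : Matrix (Fin N) (Fin K) ℝ) (u : Fin K) (y : Fin N → ℂ) : ℂ :=
  (fun i => (S i u : ℂ)) ⬝ᵥ y

/-- The cross-correlation `ρ_{uk} = s_uᵀ s_k`. -/
def crossCorr {N K : ℕ} (S : Matrix (Fin N) (Fin K) ℝ) (u k : Fin K) : ℝ :=
  (fun i => S i u) ⬝ᵥ (fun i => S i k)

/-- The interference energy `∑_{k ≠ u} ρ_{uk}²` seen by user `u`. -/
def interferenceEnergy {N K : ℕ} (S : Matrix (Fin N) (Fin K) ℝ) (u : Fin K) : ℝ :=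
  ∑ k ∈ Finset.univ.erase u, crossCorr S u k ^ 2

/-- A time-hopping system with `K` users, `Ns` subgroups of `Nh` chips, and Gaussian inputs:
the spreading matrix, the symbols and the noise are independent random variables, the symbols
are i.i.d. circular complex Gaussian of variance `E`, and the noise is circular complex
Gaussian with covariance `N₀ I`. -/
structure IsGaussianTHSystem {Ω : Type*} [MeasurableSpace Ω] (P : Measure Ω)
    (Ns Nh K : ℕ) (E N₀ : ℝ≥0) (S : Ω → Matrix (Fin (Ns * Nh)) (Fin K) ℝ)
    (b : Ω → Fin K → ℂ) (n : Ω → Fin (Ns * Nh) → ℂ) : Prop where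
  measurable_matrix : Measurable S
  measurable_symbols : Measurable b
  measurable_noise : Measurable n
  law_matrix : P.map S = thMatrixLaw Ns Nh K
  law_symbols : P.map b = Measure.pi fun _ => circularGaussian E
  law_noise : P.map n = Measure.pi fun _ => circularGaussian N₀
  indep_matrix : IndepFun S (fun ω => (b ω, n ω)) P
  indep_symbols_noise : IndepFun b n P

/-- `I(y_u ; b_u | S)` in bits per channel use, where `y_u` is the matched-filter output of
user `u`. It takes values in `[0, ∞]`. -/
def sumfMutualInfo {Ω : Type*} [MeasurableSpace Ω] (P : Measure Ω) [IsFiniteMeasure P]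
    {N K : ℕ} (S : Ω → Matrix (Fin N) (Fin K) ℝ) (b : Ω → Fin K → ℂ) (n : Ω → Fin N → ℂ)
    (u : Fin K) : ℝ≥0∞ :=
  condMutualInfo (fun ω => matchedFilter (S ω) u (received (S ω) (b ω) (n ω)))
    (fun ω => b ω u) S P / ENNReal.ofReal (Real.log 2)

/-- The `k`-th term `e^{-Ns² β} (Ns² β)^k / k! * log₂ (1 + γ / (1 + k γ / Ns²))`. -/
def poissonRateTerm (Ns : ℕ) (β γ : ℝ) (k : ℕ) : ℝ :=
  Real.exp (-((Ns : ℝ) ^ 2 * β)) * ((Ns : ℝ) ^ 2 * β) ^ k / (k.factorial : ℝ) *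
    Real.logb 2 (1 + γ / (1 + (k : ℝ) / (Ns : ℝ) ^ 2 * γ))

end THCDMA

end

/-!
Given `S`, the matched-filter output is `b_u` plus an independent circular Gaussian variable of
variance `ρ² E + N₀`, where `ρ²` is the interference energy, so that the conditional mutual
information is the expectation of `log₂ (1 + γ / (1 + ρ² γ))`, a bounded continuous function of
`ρ²`. It therefore suffices that `ρ²` converges in distribution to `X / Ns²`. Relative to the code
of user `u` the other codes are again independent and uniform, hence the characteristic function
of `ρ²` is `φ ^ (K - 1)`, with `φ` that of one squared cross-correlation. A pair of codes collides
in a given subgroup with probability `1 / Nh`, a single collision gives `1 / Ns²`, and two or more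
have probability `O(Nh⁻²)`; so `φ(t) = 1 + (Ns / Nh) (exp(i t / Ns²) - 1) + O(Nh⁻²)`, and
`φ ^ (K - 1)` tends to the characteristic function of `X / Ns²`.
-/

noncomputable section

namespace THCDMA

/-! ### Circular Gaussian laws -/

theorem measurable_complexMk : Measurable (fun p : ℝ × ℝ => (⟨p.1, p.2⟩ : ℂ)) :=
  Complex.measurableEquivRealProd.symm.measurable

instance isProbabilityMeasure_circularGaussian (v : ℝ≥0) :
    IsProbabilityMeasure (circularGaussian v) :=
  Measure.isProbabilityMeasure_map measurable_complexMk.aemeasurable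

theorem charFun_circularGaussian (v : ℝ≥0) (w : ℂ) :
    charFun (circularGaussian v) w = Complex.exp (-(v * ‖w‖ ^ 2 / 4)) := by
  have hre := charFun_gaussianReal (μ := 0) (v := v / 2) w.re
  have him := charFun_gaussianReal (μ := 0) (v := v / 2) w.im
  rw [charFun_apply] at hre him ⊢
  rw [circularGaussian, integral_map measurable_complexMk.aemeasurable (by fun_prop)]
  have hsplit : ∀ p : ℝ × ℝ,
      Complex.exp ((inner ℝ (⟨p.1, p.2⟩ : ℂ) w : ℝ) * Complex.I) =
        Complex.exp ((inner ℝ p.1 w.re : ℝ) * Complex.I) *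
          Complex.exp ((inner ℝ p.2 w.im : ℝ) * Complex.I) := by
    intro p
    rw [← Complex.exp_add, ← add_mul, ← Complex.ofReal_add]
    congr 3
    simp [Complex.inner]
  have hnorm : (‖w‖ : ℂ) ^ 2 = w.re * w.re + w.im * w.im := by
    exact_mod_cast (Complex.sq_norm w).trans (Complex.normSq_apply w)
  simp_rw [hsplit]
  rw [integral_prod_mul (fun x : ℝ => Complex.exp ((inner ℝ x w.re : ℝ) * Complex.I))
    (fun x : ℝ => Complex.exp ((inner ℝ x w.im : ℝ) * Complex.I)), hre, him,
    ← Complex.exp_add, hnorm]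
  congr 1
  push_cast
  ring

theorem map_smul_circularGaussian (c : ℝ) (v : ℝ≥0) :
    (circularGaussian v).map (c • ·) = circularGaussian (‖c‖₊ ^ 2 * v) := by
  have : IsProbabilityMeasure ((circularGaussian v).map (c • ·)) :=
    Measure.isProbabilityMeasure_map (by fun_prop)
  refine Measure.ext_of_charFun (funext fun t => ?_)
  rw [charFun_map_smul, charFun_circularGaussian, charFun_circularGaussian, norm_smul]
  push_cast
  ring_nf

theorem circularGaussian_conv_circularGaussian (s a : ℝ≥0) :
    circularGaussian s ∗ circularGaussian a = circularGaussian (s + a) := by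
  refine Measure.ext_of_charFun (funext fun t => ?_)
  rw [charFun_conv, charFun_circularGaussian, charFun_circularGaussian,
    charFun_circularGaussian, ← Complex.exp_add]
  push_cast
  ring_nf

theorem circularGaussian_zero : circularGaussian 0 = Measure.dirac 0 := by
  refine Measure.ext_of_charFun (funext fun t => ?_)
  simp [charFun_circularGaussian]

theorem hasLaw_sum_smul_circularGaussian {Ω ι : Type*} [MeasurableSpace Ω] {P : Measure Ω}
    {X : ι → Ω → ℂ} {v : ι → ℝ≥0} (hX : ∀ i, HasLaw (X i) (circularGaussian (v i)) P)
    (hind : iIndepFun X P) (w : ι → ℝ) (s : Finset ι) :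
    HasLaw (∑ i ∈ s, w i • X i) (circularGaussian (∑ i ∈ s, ‖w i‖₊ ^ 2 * v i)) P := by
  classical
  have : IsProbabilityMeasure P := hind.isProbabilityMeasure
  have hwX : ∀ i, HasLaw (w i • X i) (circularGaussian (‖w i‖₊ ^ 2 * v i)) P := fun i =>
    HasLaw.comp (Y := fun z : ℂ => w i • z)
      ⟨by fun_prop, map_smul_circularGaussian (w i) (v i)⟩ (hX i)
  have hwind : iIndepFun (fun i => w i • X i) P :=
    hind.comp (fun i z => w i • z) fun i => measurable_const_smul (w i)
  induction s using Finset.induction_on with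
  | empty =>
    simp only [Finset.sum_empty, circularGaussian_zero]
    exact hasLaw_dirac_of_ae_eq ae_eq_rfl
  | insert i s hi ih =>
    rw [Finset.sum_insert hi, Finset.sum_insert hi, ← circularGaussian_conv_circularGaussian]
    exact (hwind.indepFun_finsetSum_of_notMem₀ (fun j => (hwX j).aemeasurable) hi).symm.hasLaw_add
      (hwX i) ih

/-- The density of the circular Gaussian law of variance `v ≠ 0`. -/
def circularPDF (v : ℝ≥0) (z : ℂ) : ℝ := (Real.pi * v)⁻¹ * Real.exp (-(‖z‖ ^ 2 / v))

theorem circularPDF_pos {v : ℝ≥0} (hv : v ≠ 0) (z : ℂ) : 0 < circularPDF v z := by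
  have : 0 < (v : ℝ) := by positivity
  unfold circularPDF
  positivity

@[fun_prop]
theorem measurable_circularPDF (v : ℝ≥0) : Measurable (circularPDF v) := by
  unfold circularPDF
  fun_prop

theorem gaussianPDFReal_mul_gaussianPDFReal (v : ℝ≥0) (x y : ℝ) :
    gaussianPDFReal 0 (v / 2) x * gaussianPDFReal 0 (v / 2) y = circularPDF v ⟨x, y⟩ := by
  rw [gaussianPDFReal, gaussianPDFReal, circularPDF, mul_mul_mul_comm, ← Real.exp_add,
    ← mul_inv, Real.mul_self_sqrt (by positivity), Complex.sq_norm, Complex.normSq_mk]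
  congr 2
  · push_cast; ring
  · push_cast; ring

theorem map_withDensity_comp {α β : Type*} [MeasurableSpace α] [MeasurableSpace β]
    {μ : Measure α} {ν : Measure β} {T : α → β} (hT : MeasurePreserving T μ ν) {g : β → ℝ≥0∞}
    (hg : Measurable g) : (μ.withDensity (g ∘ T)).map T = ν.withDensity g := by
  ext s hs
  rw [Measure.map_apply hT.measurable hs, withDensity_apply _ (hT.measurable hs),
    withDensity_apply _ hs, ← hT.setLIntegral_comp_preimage hs hg]
  rfl

theorem circularGaussian_eq_withDensity {v : ℝ≥0} (hv : v ≠ 0) :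
    circularGaussian v = volume.withDensity (fun z => ENNReal.ofReal (circularPDF v z)) := by
  have hv2 : v / 2 ≠ 0 := by simpa using hv
  have hmk : MeasurePreserving (fun p : ℝ × ℝ => (⟨p.1, p.2⟩ : ℂ)) volume volume :=
    Complex.volume_preserving_equiv_real_prod.symm _
  rw [circularGaussian, gaussianReal_of_var_ne_zero _ hv2,
    prod_withDensity (measurable_gaussianPDF _ _) (measurable_gaussianPDF _ _),
    ← Measure.volume_eq_prod, ← map_withDensity_comp hmk (by fun_prop)]
  congr 2
  ext p
  rw [gaussianPDF, gaussianPDF, ← ENNReal.ofReal_mul (gaussianPDFReal_nonneg _ _ _),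
    gaussianPDFReal_mul_gaussianPDFReal]
  rfl

theorem integrable_norm_sq_circularGaussian (v : ℝ≥0) :
    Integrable (fun z => ‖z‖ ^ 2) (circularGaussian v) := by
  have h : Integrable (fun x : ℝ => x ^ 2) (gaussianReal 0 (v / 2)) :=
    (memLp_id_gaussianReal 2).integrable_sq
  rw [circularGaussian, integrable_map_measure (by fun_prop) measurable_complexMk.aemeasurable]
  refine ((h.comp_fst _).add (h.comp_snd _)).congr (ae_of_all _ fun p => ?_)
  simp [Complex.sq_norm, Complex.normSq_mk, ← sq]

theorem integral_norm_sq_circularGaussian (v : ℝ≥0) :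
    ∫ z, ‖z‖ ^ 2 ∂(circularGaussian v) = v := by
  have h : Integrable (fun x : ℝ => x ^ 2) (gaussianReal 0 (v / 2)) :=
    (memLp_id_gaussianReal 2).integrable_sq
  have hvar : ∫ x, x ^ 2 ∂(gaussianReal 0 (v / 2)) = v / 2 := by
    have hid := variance_fun_id_gaussianReal (μ := 0) (v := v / 2)
    rw [variance_eq_integral (by fun_prop)] at hid
    simpa using hid
  rw [circularGaussian, integral_map measurable_complexMk.aemeasurable (by fun_prop)]
  simp_rw [Complex.sq_norm, Complex.normSq_mk, ← sq]
  rw [integral_add (h.comp_fst _) (h.comp_snd _),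
    integral_fun_fst (fun x : ℝ => x ^ 2), integral_fun_snd (fun x : ℝ => x ^ 2), hvar]
  simp

/-! ### Mutual information of Gaussian channels -/

/-- The mutual information `I(X ; Y)`, in nats: the divergence of the joint law of `(X, Y)` from
the product of the laws of `X` and `Y`. -/
def mutualInfo {Ω 𝓧 𝓨 : Type*} [MeasurableSpace Ω] [MeasurableSpace 𝓧] [MeasurableSpace 𝓨]
    (X : Ω → 𝓧) (Y : Ω → 𝓨) (P : Measure Ω) : ℝ≥0∞ :=
  InformationTheory.klDiv (P.map fun ω => (X ω, Y ω)) ((P.map X).prod (P.map Y))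

theorem klDiv_withDensity_ofReal {α : Type*} [MeasurableSpace α] {ν : Measure α}
    [IsProbabilityMeasure ν] {r : α → ℝ} (hr : Measurable r) (hpos : ∀ x, 0 < r x)
    [IsProbabilityMeasure (ν.withDensity fun x => ENNReal.ofReal (r x))]
    (hint : Integrable (fun x => Real.log (r x))
      (ν.withDensity fun x => ENNReal.ofReal (r x))) :
    InformationTheory.klDiv (ν.withDensity fun x => ENNReal.ofReal (r x)) ν =
      ENNReal.ofReal
        (∫ x, Real.log (r x) ∂(ν.withDensity fun x => ENNReal.ofReal (r x))) := by
  set ρ := ν.withDensity fun x => ENNReal.ofReal (r x)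
  have hac : ρ ≪ ν := withDensity_absolutelyContinuous _ _
  have hllr : llr ρ ν =ᵐ[ρ] fun x => Real.log (r x) := by
    filter_upwards [hac.ae_le (Measure.rnDeriv_withDensity ν hr.ennreal_ofReal)] with x hx
    rw [llr, hx, ENNReal.toReal_ofReal (hpos x).le]
  rw [InformationTheory.klDiv_of_ac_of_integrable hac (hint.congr hllr.symm),
    integral_congr_ae hllr]
  simp

/-- The likelihood ratio at an output-input pair `p = (z + x, x)` between the joint law and the
product of the laws, when the noise `z` has variance `s` and the output has variance `t`. -/
def channelRatio (s t : ℝ≥0) (p : ℂ × ℂ) : ℝ :=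
  circularPDF s (p.1 - p.2) / circularPDF t p.1

@[fun_prop]
theorem measurable_channelRatio (s t : ℝ≥0) : Measurable (channelRatio s t) := by
  unfold channelRatio
  fun_prop

theorem channelRatio_pos {s t : ℝ≥0} (hs : s ≠ 0) (ht : t ≠ 0) (p : ℂ × ℂ) :
    0 < channelRatio s t p :=
  div_pos (circularPDF_pos hs _) (circularPDF_pos ht _)

theorem log_channelRatio_add {s : ℝ≥0} (hs : s ≠ 0) (a : ℝ≥0) (z x : ℂ) :
    Real.log (channelRatio s (s + a) (z + x, x)) =
      Real.log (1 + a / s) - ‖z‖ ^ 2 / s + ‖z + x‖ ^ 2 / (s + a : ℝ≥0) := by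
  have : 0 < (s : ℝ) := by positivity
  have : 0 ≤ (a : ℝ) := a.2
  have hconst : (Real.pi * s)⁻¹ / (Real.pi * (s + a : ℝ≥0))⁻¹ = 1 + (a : ℝ) / s := by
    push_cast
    field_simp
  rw [channelRatio, circularPDF, circularPDF, mul_div_mul_comm, hconst, ← Real.exp_sub,
    Real.log_mul (by positivity) (Real.exp_ne_zero _), Real.log_exp, add_sub_cancel_right]
  ring

theorem map_shear_circularGaussian_prod {s t : ℝ≥0} (hs : s ≠ 0) (ht : t ≠ 0)
    (μ : Measure ℂ) [SFinite μ] :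
    ((circularGaussian s).prod μ).map (fun p => (p.1 + p.2, p.2)) =
      ((circularGaussian t).prod μ).withDensity fun p => ENNReal.ofReal (channelRatio s t p) := by
  have hshear : MeasurePreserving (fun p : ℂ × ℂ => (p.1 + p.2, p.2))
      (volume.prod μ) (volume.prod μ) := measurePreserving_add_prod volume μ
  rw [circularGaussian_eq_withDensity hs, circularGaussian_eq_withDensity ht,
    prod_withDensity_left (by fun_prop), prod_withDensity_left (by fun_prop),
    ← withDensity_mul _ (by fun_prop) (by fun_prop)]
  refine Eq.trans ?_ (map_withDensity_comp hshear (by fun_prop))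
  congr 2
  ext p
  have hpos := circularPDF_pos ht (p.1 + p.2)
  simp only [Function.comp_apply, Pi.mul_apply, channelRatio, add_sub_cancel_right]
  rw [← ENNReal.ofReal_mul hpos.le, mul_div_cancel₀ _ hpos.ne']

section RandomVariables

variable {Ω : Type*} [MeasurableSpace Ω] {P : Measure Ω}

theorem integrable_norm_sq_of_hasLaw {X : Ω → ℂ} {v : ℝ≥0}
    (hX : HasLaw X (circularGaussian v) P) : Integrable (fun ω => ‖X ω‖ ^ 2) P :=
  Integrable.comp_aemeasurable (g := fun z => ‖z‖ ^ 2)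
    (hX.map_eq ▸ integrable_norm_sq_circularGaussian v) hX.aemeasurable

theorem integral_norm_sq_of_hasLaw {X : Ω → ℂ} {v : ℝ≥0}
    (hX : HasLaw X (circularGaussian v) P) : ∫ ω, ‖X ω‖ ^ 2 ∂P = v :=
  (hX.integral_comp (f := fun z => ‖z‖ ^ 2) (by fun_prop)).trans
    (integral_norm_sq_circularGaussian v)

theorem map_add_prodMk_circularGaussian {Z X : Ω → ℂ} {s t : ℝ≥0} (hs : s ≠ 0) (ht : t ≠ 0)
    {μ : Measure ℂ} [IsProbabilityMeasure μ] (hZ : HasLaw Z (circularGaussian s) P)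
    (hX : HasLaw X μ P) (hind : IndepFun Z X P) :
    P.map (fun ω => ((Z + X) ω, X ω)) =
      ((circularGaussian t).prod μ).withDensity fun p => ENNReal.ofReal (channelRatio s t p) := by
  have : IsProbabilityMeasure P := hZ.isProbabilityMeasure
  rw [← map_shear_circularGaussian_prod hs ht,
    ← ((indepFun_iff_hasLaw_prodMk_prod hZ hX).1 hind).map_eq,
    AEMeasurable.map_map_of_aemeasurable (by fun_prop) (by fun_prop)]
  rfl

theorem integrable_log_channelRatio_add [IsProbabilityMeasure P] {Z X : Ω → ℂ} {s a : ℝ≥0}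
    (hs : s ≠ 0) (hZ : HasLaw Z (circularGaussian s) P)
    (hY : HasLaw (Z + X) (circularGaussian (s + a)) P) :
    Integrable (fun ω => Real.log (channelRatio s (s + a) ((Z + X) ω, X ω))) P := by
  simp only [Pi.add_apply, log_channelRatio_add hs]
  exact ((integrable_const _).sub ((integrable_norm_sq_of_hasLaw hZ).div_const s)).add
    ((integrable_norm_sq_of_hasLaw hY).div_const (s + a : ℝ≥0))

theorem integral_log_channelRatio_add [IsProbabilityMeasure P] {Z X : Ω → ℂ} {s a : ℝ≥0}
    (hs : s ≠ 0) (hZ : HasLaw Z (circularGaussian s) P)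
    (hY : HasLaw (Z + X) (circularGaussian (s + a)) P) :
    ∫ ω, Real.log (channelRatio s (s + a) ((Z + X) ω, X ω)) ∂P = Real.log (1 + a / s) := by
  have hsa : s + a ≠ 0 := by simp [hs]
  have hintZ := (integrable_norm_sq_of_hasLaw hZ).div_const s
  have hintY := (integrable_norm_sq_of_hasLaw hY).div_const (s + a : ℝ≥0)
  have hintC : Integrable (fun ω => Real.log (1 + a / s) - ‖Z ω‖ ^ 2 / s) P :=
    (integrable_const _).sub hintZ
  have hEZ : ∫ ω, ‖Z ω‖ ^ 2 / s ∂P = 1 := by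
    rw [integral_div, integral_norm_sq_of_hasLaw hZ, div_self (by exact_mod_cast hs)]
  have hEY : ∫ ω, ‖(Z + X) ω‖ ^ 2 / (s + a : ℝ≥0) ∂P = 1 := by
    rw [integral_div, integral_norm_sq_of_hasLaw hY, div_self (by exact_mod_cast hsa)]
  calc ∫ ω, Real.log (channelRatio s (s + a) ((Z + X) ω, X ω)) ∂P
    _ = ∫ ω, (Real.log (1 + a / s) - ‖Z ω‖ ^ 2 / s + ‖(Z + X) ω‖ ^ 2 / (s + a : ℝ≥0)) ∂P := by
      simp only [Pi.add_apply, log_channelRatio_add hs]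
    _ = Real.log (1 + a / s) - 1 + 1 := by
      rw [integral_add hintC hintY, integral_sub (integrable_const _) hintZ, hEZ, hEY]
      simp
    _ = Real.log (1 + a / s) := sub_add_cancel _ _

theorem mutualInfo_add_of_circularGaussian {Z X : Ω → ℂ} {s a : ℝ≥0} (hs : s ≠ 0)
    (hZ : HasLaw Z (circularGaussian s) P) (hX : HasLaw X (circularGaussian a) P)
    (hind : IndepFun Z X P) :
    mutualInfo (Z + X) X P = ENNReal.ofReal (Real.log (1 + a / s)) := by
  have : IsProbabilityMeasure P := hZ.isProbabilityMeasure
  have hsa : s + a ≠ 0 := by simp [hs]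
  have hY : HasLaw (Z + X) (circularGaussian (s + a)) P := by
    simpa only [circularGaussian_conv_circularGaussian] using hind.hasLaw_add hZ hX
  have hYX : AEMeasurable (fun ω => ((Z + X) ω, X ω)) P := hY.aemeasurable.prodMk hX.aemeasurable
  have hlog : Measurable fun p => Real.log (channelRatio s (s + a) p) :=
    (measurable_channelRatio s (s + a)).log
  have hdens := map_add_prodMk_circularGaussian hs hsa hZ hX hind
  have hprob := Measure.isProbabilityMeasure_map hYX
  have hint : Integrable (fun p => Real.log (channelRatio s (s + a) p))
      (P.map fun ω => ((Z + X) ω, X ω)) :=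
    (integrable_map_measure hlog.aestronglyMeasurable hYX).2
      (integrable_log_channelRatio_add hs hZ hY)
  rw [hdens] at hprob hint
  rw [mutualInfo, hY.map_eq, hX.map_eq, hdens,
    klDiv_withDensity_ofReal (by fun_prop) (channelRatio_pos hs hsa) hint, ← hdens,
    integral_map hYX hlog.aestronglyMeasurable, integral_log_channelRatio_add hs hZ hY]

theorem mutualInfo_sum_smul_of_circularGaussian {ι : Type*} [Fintype ι] [DecidableEq ι]
    {X : ι → Ω → ℂ} {v : ι → ℝ≥0} (hX : ∀ i, HasLaw (X i) (circularGaussian (v i)) P)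
    (hind : iIndepFun X P) {w : ι → ℝ} {i : ι} (hwi : w i = 1)
    (hnoise : ∑ j ∈ Finset.univ.erase i, ‖w j‖₊ ^ 2 * v j ≠ 0) :
    mutualInfo (∑ j, w j • X j) (X i) P = ENNReal.ofReal
      (Real.log (1 + v i / (∑ j ∈ Finset.univ.erase i, ‖w j‖₊ ^ 2 * v j : ℝ≥0))) := by
  have hwind : iIndepFun (fun j => w j • X j) P :=
    hind.comp (fun j z => w j • z) fun j => measurable_const_smul (w j)
  have hZX := hwind.indepFun_finsetSum_of_notMem₀
    (fun j => (hX j).aemeasurable.const_smul (w j)) (Finset.notMem_erase i Finset.univ)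
  rw [hwi, one_smul] at hZX
  rw [← Finset.sum_erase_add Finset.univ _ (Finset.mem_univ i), hwi, one_smul]
  exact mutualInfo_add_of_circularGaussian hnoise
    (hasLaw_sum_smul_circularGaussian hX hind w _) (hX i) hZX

end RandomVariables

/-! ### Conditioning on an independent variable -/

section Freezing

variable {Ω 𝓦 𝓧 𝓨 𝓩 : Type*} [MeasurableSpace Ω] [MeasurableSpace 𝓦] [MeasurableSpace 𝓧]
  [MeasurableSpace 𝓨] [MeasurableSpace 𝓩]

theorem map_kernel_id_prod_const_apply {ν : Measure 𝓦} [SFinite ν] {f : 𝓩 → 𝓦 → 𝓨}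
    (hf : Measurable (Function.uncurry f)) (z : 𝓩) :
    (Kernel.id ×ₖ Kernel.const 𝓩 ν).map (Function.uncurry f) z = ν.map (f z) := by
  rw [Kernel.map_apply _ hf, Kernel.prod_apply, Kernel.id_apply, Kernel.const_apply,
    Measure.dirac_prod, Measure.map_map hf (by fun_prop)]
  rfl

theorem map_prodMk_prod_eq_compProd {μ : Measure 𝓩} [SFinite μ] {ν : Measure 𝓦}
    [IsProbabilityMeasure ν] {f : 𝓩 → 𝓦 → 𝓨} (hf : Measurable (Function.uncurry f)) :
    (μ.prod ν).map (fun p => (p.1, f p.1 p.2)) =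
      μ ⊗ₘ (Kernel.id ×ₖ Kernel.const 𝓩 ν).map (Function.uncurry f) := by
  have := Kernel.IsMarkovKernel.map (Kernel.id ×ₖ Kernel.const 𝓩 ν) hf
  have hg : Measurable fun p : 𝓩 × 𝓦 => (p.1, f p.1 p.2) := measurable_fst.prodMk hf
  ext s hs
  rw [Measure.map_apply hg hs, Measure.prod_apply (hg hs), Measure.compProd_apply hs]
  refine lintegral_congr fun z => ?_
  rw [map_kernel_id_prod_const_apply hf,
    Measure.map_apply hf.of_uncurry_left (measurable_prodMk_left hs)]
  rfl

variable {P : Measure Ω} [IsProbabilityMeasure P] {Z : Ω → 𝓩} {W : Ω → 𝓦}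

theorem condDistrib_ae_eq_map_of_indepFun [StandardBorelSpace 𝓨] [Nonempty 𝓨]
    (hZ : Measurable Z) (hW : Measurable W) (hind : IndepFun Z W P) {f : 𝓩 → 𝓦 → 𝓨}
    (hf : Measurable (Function.uncurry f)) :
    ∀ᵐ z ∂(P.map Z), condDistrib (fun ω => f (Z ω) (W ω)) Z P z = P.map fun ω => f z (W ω) := by
  have := Measure.isProbabilityMeasure_map hW.aemeasurable (μ := P)
  have := Kernel.IsMarkovKernel.map (Kernel.id ×ₖ Kernel.const 𝓩 (P.map W)) hf
  have hZW := (indepFun_iff_map_prod_eq_prod_map_map hZ.aemeasurable hW.aemeasurable).1 hind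
  have hjoint : P.map (fun ω => (Z ω, f (Z ω) (W ω))) =
      P.map Z ⊗ₘ (Kernel.id ×ₖ Kernel.const 𝓩 (P.map W)).map (Function.uncurry f) := by
    rw [← map_prodMk_prod_eq_compProd hf, ← hZW]
    exact (Measure.map_map (measurable_fst.prodMk hf) (hZ.prodMk hW)).symm
  filter_upwards [condDistrib_ae_eq_of_measure_eq_compProd Z
    (hf.comp (hZ.prodMk hW)).aemeasurable hjoint] with z hz
  exact hz.trans ((map_kernel_id_prod_const_apply hf z).trans
    (Measure.map_map hf.of_uncurry_left hW))

theorem condMutualInfo_eq_lintegral_mutualInfo [StandardBorelSpace 𝓧] [Nonempty 𝓧]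
    [StandardBorelSpace 𝓨] [Nonempty 𝓨] (hZ : Measurable Z) (hW : Measurable W)
    (hind : IndepFun Z W P) {f : 𝓩 → 𝓦 → 𝓧} (hf : Measurable (Function.uncurry f))
    {g : 𝓩 → 𝓦 → 𝓨} (hg : Measurable (Function.uncurry g)) :
    condMutualInfo (fun ω => f (Z ω) (W ω)) (fun ω => g (Z ω) (W ω)) Z P =
      ∫⁻ z, mutualInfo (fun ω => f z (W ω)) (fun ω => g z (W ω)) P ∂(P.map Z) := by
  refine lintegral_congr_ae ?_
  filter_upwards [condDistrib_ae_eq_map_of_indepFun hZ hW hind hf,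
    condDistrib_ae_eq_map_of_indepFun hZ hW hind hg,
    condDistrib_ae_eq_map_of_indepFun hZ hW hind (f := fun z w => (f z w, g z w))
      (hf.prodMk hg)] with z hz_f hz_g hz_fg
  rw [hz_f, hz_g, hz_fg, mutualInfo]

end Freezing

/-! ### The matched-filter channel for a fixed spreading matrix -/

theorem measurable_entry {m n : Type*} (i : m) (k : n) :
    Measurable (fun S : Matrix m n ℝ => S i k) :=
  (measurable_pi_apply k).comp (measurable_pi_apply i)

theorem measurable_crossCorr {N K : ℕ} (u k : Fin K) :
    Measurable (fun S : Matrix (Fin N) (Fin K) ℝ => crossCorr S u k) := by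
  unfold crossCorr dotProduct
  exact Finset.measurable_sum _ fun i _ => (measurable_entry i u).mul (measurable_entry i k)

theorem measurable_interferenceEnergy {N K : ℕ} (u : Fin K) :
    Measurable (fun S : Matrix (Fin N) (Fin K) ℝ => interferenceEnergy S u) :=
  Finset.measurable_sum _ fun k _ => (measurable_crossCorr u k).pow_const 2

section MatchedFilter

variable {N K : ℕ} (S : Matrix (Fin N) (Fin K) ℝ) (u : Fin K)

/-- The coefficients of the matched-filter output of user `u` as a linear form in the symbols
(left summand) and the noise samples (right summand). -/
def filterWeight : Fin K ⊕ Fin N → ℝ :=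
  Sum.elim (crossCorr S u) fun j => S j u

theorem matchedFilter_received (b : Fin K → ℂ) (n : Fin N → ℂ) :
    matchedFilter S u (received S b n) = ∑ i, filterWeight S u i • Sum.elim b n i := by
  rw [Fintype.sum_sum_type, matchedFilter, received, dotProduct_add, Matrix.dotProduct_mulVec]
  simp [filterWeight, dotProduct, Matrix.vecMul, crossCorr]

theorem measurable_filterWeight (i : Fin K ⊕ Fin N) :
    Measurable (fun S : Matrix (Fin N) (Fin K) ℝ => filterWeight S u i) := by
  rcases i with k | j
  exacts [measurable_crossCorr u k, measurable_entry j u]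

theorem measurable_matchedFilter_received :
    Measurable (fun p : Matrix (Fin N) (Fin K) ℝ × (Fin K → ℂ) × (Fin N → ℂ) =>
      matchedFilter p.1 u (received p.1 p.2.1 p.2.2)) := by
  simp_rw [matchedFilter_received]
  refine Finset.measurable_sum _ fun i _ =>
    ((measurable_filterWeight u i).comp measurable_fst).smul ?_
  rcases i with k | j <;> simp only [Sum.elim_inl, Sum.elim_inr] <;> fun_prop

theorem interferenceEnergy_nonneg : 0 ≤ interferenceEnergy S u :=
  Finset.sum_nonneg fun _ _ => sq_nonneg _

theorem sum_filterWeight_erase {S : Matrix (Fin N) (Fin K) ℝ} {u : Fin K}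
    (hS : crossCorr S u u = 1) (E N₀ : ℝ≥0) :
    ((∑ i ∈ Finset.univ.erase (Sum.inl u), ‖filterWeight S u i‖₊ ^ 2 *
      Sum.elim (fun _ => E) (fun _ => N₀) i : ℝ≥0) : ℝ) = interferenceEnergy S u * E + N₀ := by
  have herase : (Finset.univ.erase (Sum.inl u) : Finset (Fin K ⊕ Fin N)) =
      (Finset.univ.erase u).disjSum Finset.univ := by
    ext (k | j) <;> simp
  have hnoise : ∑ j, S j u ^ 2 = 1 := by
    rw [← hS, crossCorr, dotProduct]
    exact Finset.sum_congr rfl fun _ _ => sq _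
  rw [herase, Finset.sum_disjSum]
  simp [filterWeight, interferenceEnergy, ← Finset.sum_mul, hnoise]

end MatchedFilter

section ProductLaw

variable {Ω ι ι' 𝓧 : Type*} [Fintype ι] [Fintype ι'] [MeasurableSpace Ω] [MeasurableSpace 𝓧]
  {P : Measure Ω}

theorem hasLaw_sumElim [IsFiniteMeasure P] {μ : ι ⊕ ι' → Measure 𝓧} [∀ i, SigmaFinite (μ i)]
    {b : Ω → ι → 𝓧} {n : Ω → ι' → 𝓧} (hb : HasLaw b (Measure.pi fun i => μ (Sum.inl i)) P)
    (hn : HasLaw n (Measure.pi fun i => μ (Sum.inr i)) P) (hind : IndepFun b n P) :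
    HasLaw (fun ω => Sum.elim (b ω) (n ω)) (Measure.pi μ) P := by
  have h := (measurePreserving_sumPiEquivProdPi_symm μ).fun_comp_hasLaw
    ((indepFun_iff_hasLaw_prodMk_prod hb hn).1 hind)
  convert h using 2 with ω
  ext (i | i) <;> rfl

theorem hasLaw_eval_of_hasLaw_pi {X : Ω → ι → 𝓧} {μ : ι → Measure 𝓧}
    [∀ i, IsProbabilityMeasure (μ i)] (hX : HasLaw X (Measure.pi μ) P) (i : ι) :
    HasLaw (fun ω => X ω i) (μ i) P :=
  (measurePreserving_eval μ i).fun_comp_hasLaw hX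

theorem iIndepFun_of_hasLaw_pi {X : Ω → ι → 𝓧} {μ : ι → Measure 𝓧}
    [∀ i, IsProbabilityMeasure (μ i)] (hX : HasLaw X (Measure.pi μ) P) :
    iIndepFun (fun i ω => X ω i) P :=
  have := hX.isProbabilityMeasure
  (iIndepFun_iff_hasLaw_pi_pi (hasLaw_eval_of_hasLaw_pi hX)).2 hX

end ProductLaw

theorem mutualInfo_matchedFilter {Ω : Type*} [MeasurableSpace Ω] {P : Measure Ω}
    {N K : ℕ} {E N₀ : ℝ≥0} (hN₀ : 0 < N₀) {b : Ω → Fin K → ℂ} {n : Ω → Fin N → ℂ}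
    (hb : HasLaw b (Measure.pi fun _ => circularGaussian E) P)
    (hn : HasLaw n (Measure.pi fun _ => circularGaussian N₀) P) (hind : IndepFun b n P)
    {S : Matrix (Fin N) (Fin K) ℝ} {u : Fin K} (hS : crossCorr S u u = 1) :
    mutualInfo (fun ω => matchedFilter S u (received S (b ω) (n ω))) (fun ω => b ω u) P =
      ENNReal.ofReal (Real.log (1 + E / (interferenceEnergy S u * E + N₀))) := by
  have : IsProbabilityMeasure P := hb.isProbabilityMeasure
  set v : Fin K ⊕ Fin N → ℝ≥0 := Sum.elim (fun _ => E) fun _ => N₀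
  have hlaw : HasLaw (fun ω => Sum.elim (b ω) (n ω))
      (Measure.pi fun i => circularGaussian (v i)) P := hasLaw_sumElim hb hn hind
  have hvar := sum_filterWeight_erase hS E N₀
  have hpos : 0 < interferenceEnergy S u * E + N₀ :=
    add_pos_of_nonneg_of_pos (mul_nonneg (interferenceEnergy_nonneg S u) E.2) hN₀
  have hinfo := mutualInfo_sum_smul_of_circularGaussian (hasLaw_eval_of_hasLaw_pi hlaw)
    (iIndepFun_of_hasLaw_pi hlaw) (w := filterWeight S u) (i := Sum.inl u) hS
    (by rw [← NNReal.coe_ne_zero, hvar]; exact hpos.ne')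
  have hsum : (fun ω => matchedFilter S u (received S (b ω) (n ω))) =
      ∑ i, filterWeight S u i • fun ω => Sum.elim (b ω) (n ω) i := by
    ext ω
    simp only [matchedFilter_received, Finset.sum_apply, Pi.smul_apply]
  rw [hsum]
  rwa [hvar] at hinfo

/-! ### Random time-hopping codes -/

section Codes

variable {Ns Nh K : ℕ}

/-- The law of the pulses of one user: independent uniform positions and signs. -/
def codeLaw (Ns Nh : ℕ) : Measure (Fin Ns → Fin Nh × Bool) :=
  Measure.pi fun _ => uniformOn Set.univ

theorem thMatrixLaw_eq_map_pi_codeLaw (Ns Nh K : ℕ) :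
    thMatrixLaw Ns Nh K = (Measure.pi fun _ : Fin K => codeLaw Ns Nh).map thMatrix := rfl

instance isProbabilityMeasure_codeLaw (Ns Nh : ℕ) [NeZero Nh] :
    IsProbabilityMeasure (codeLaw Ns Nh) := by
  unfold codeLaw
  infer_instance

theorem pi_uniformOn_univ {ι α : Type*} [Fintype ι] [Finite α] [MeasurableSpace α]
    [MeasurableSingletonClass α] :
    Measure.pi (fun _ : ι => uniformOn (Set.univ : Set α)) = uniformOn Set.univ := by
  rw [← uniformOn_pi, Set.pi_univ]

theorem measurePreserving_uniformOn_univ {α : Type*} [Finite α] [MeasurableSpace α]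
    [MeasurableSingletonClass α] {T : α → α} (hT : Function.Bijective T) :
    MeasurePreserving T (uniformOn Set.univ) (uniformOn Set.univ) := by
  have := Fintype.ofFinite α
  refine ⟨.of_discrete, Measure.ext fun s hs => ?_⟩
  rw [Measure.map_apply .of_discrete hs, uniformOn_univ, uniformOn_univ,
    Measure.count_apply .of_discrete, Measure.count_apply hs,
    Set.encard_preimage_of_bijective hT]

/-- The sign of a pulse. -/
def pulseSign (s : Bool) : ℝ := if s then 1 else -1

theorem pulseSign_sq (s : Bool) : pulseSign s ^ 2 = 1 := by
  cases s <;> simp [pulseSign]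

theorem pulseSign_beq (s s' : Bool) : pulseSign (s == s') = pulseSign s * pulseSign s' := by
  cases s <;> cases s' <;> simp [pulseSign]

/-- The pulses of `x` as seen from those of `d`: in every subgroup, the offset modulo `Nh` of the
two positions, and whether the signs agree. -/
def relativeCode (d x : Fin Ns → Fin Nh × Bool) : Fin Ns → Fin Nh × Bool := fun m =>
  ((x m).1 - (d m).1, (d m).2 == (x m).2)

variable [NeZero Nh]

theorem relativeCode_injective (d : Fin Ns → Fin Nh × Bool) :
    Function.Injective (relativeCode d) := fun x x' h => by
  funext m
  have hm := congrFun h m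
  simp only [relativeCode, Prod.mk.injEq, sub_left_inj] at hm
  refine Prod.ext hm.1 ?_
  revert hm
  generalize (d m).2 = a, (x m).2 = b, (x' m).2 = b'
  cases a <;> cases b <;> cases b' <;> simp

/-- The subgroups in which a code collides with the reference code, when it is given relative
to that reference. -/
def collisions (z : Fin Ns → Fin Nh × Bool) : Finset (Fin Ns) := {m | (z m).1 = 0}

/-- The cross-correlation with the reference code of a code given relative to that reference. -/
def relativeCorr (z : Fin Ns → Fin Nh × Bool) : ℝ :=
  (∑ m ∈ collisions z, pulseSign (z m).2) / Ns

theorem thSequence_dotProduct (d x : Fin Ns → Fin Nh × Bool) :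
    thSequence d ⬝ᵥ thSequence x = relativeCorr (relativeCode d x) := by
  rw [dotProduct, ← finProdFinEquiv.sum_comp, Fintype.sum_prod_type, relativeCorr, collisions,
    Finset.sum_filter, Finset.sum_div]
  refine Finset.sum_congr rfl fun m _ => ?_
  simp only [thSequence, Equiv.symm_apply_apply]
  rw [Finset.sum_eq_single (d m).1 (fun i _ hi => by rw [if_neg hi.symm, zero_mul]) (by simp),
    if_pos rfl]
  simp only [relativeCode, sub_eq_zero, pulseSign_beq]
  by_cases h : (x m).1 = (d m).1
  · rw [if_pos h, if_pos h, div_mul_div_comm, Real.mul_self_sqrt (Nat.cast_nonneg _)]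
    rfl
  · rw [if_neg h, if_neg h, mul_zero, zero_div]

theorem crossCorr_thMatrix (c : Fin K → Fin Ns → Fin Nh × Bool) (u k : Fin K) :
    crossCorr (thMatrix c) u k = relativeCorr (relativeCode (c u) (c k)) :=
  thSequence_dotProduct (c u) (c k)

theorem crossCorr_thMatrix_self (hNs : 0 < Ns) (c : Fin K → Fin Ns → Fin Nh × Bool) (u : Fin K) :
    crossCorr (thMatrix c) u u = 1 := by
  have : (Ns : ℝ) ≠ 0 := by positivity
  rw [crossCorr_thMatrix]
  simp [relativeCorr, relativeCode, collisions, pulseSign, this]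

theorem measureReal_subset_collisions (A : Finset (Fin Ns)) :
    (codeLaw Ns Nh).real {z | A ⊆ collisions z} = (Nh : ℝ)⁻¹ ^ A.card := by
  have hset : {z : Fin Ns → Fin Nh × Bool | A ⊆ collisions z}
      = Set.univ.pi fun m => if m ∈ A then {0} ×ˢ Set.univ else Set.univ := by
    ext z
    simp only [Finset.subset_iff, collisions, Finset.mem_filter, Finset.mem_univ, true_and,
      Set.mem_ofPred_eq, Set.mem_pi, Set.mem_univ, forall_const]
    refine forall_congr' fun m => ?_
    split_ifs with h <;> simp [h]
  have hzero : (uniformOn (Set.univ : Set (Fin Nh × Bool))).real ({0} ×ˢ Set.univ)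
      = (Nh : ℝ)⁻¹ := by
    rw [measureReal_def, uniformOn_univ, Measure.count_apply .of_discrete, Set.encard_prod,
      Set.encard_singleton, one_mul, Set.encard_univ]
    simp [ENNReal.toReal_div, div_mul_cancel_right₀]
  have hfactor (m : Fin Ns) : (uniformOn (Set.univ : Set (Fin Nh × Bool))).real
      (if m ∈ A then {0} ×ˢ Set.univ else Set.univ) = if m ∈ A then (Nh : ℝ)⁻¹ else 1 := by
    split_ifs
    exacts [hzero, probReal_univ]
  rw [hset, codeLaw, measureReal_def, Measure.pi_pi, ENNReal.toReal_prod]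
  simp_rw [← measureReal_def, hfactor]
  simp

theorem integral_choose_card_collisions (r : ℕ) :
    ∫ z, ((collisions z).card.choose r : ℝ) ∂(codeLaw Ns Nh) = Ns.choose r * (Nh : ℝ)⁻¹ ^ r := by
  have hcount (z : Fin Ns → Fin Nh × Bool) : ((collisions z).card.choose r : ℝ)
      = ∑ A ∈ Finset.univ.powersetCard r, {z | A ⊆ collisions z}.indicator 1 z := by
    simp_rw [Set.indicator_apply, Set.mem_ofPred_eq, Pi.one_apply]
    rw [← Finset.sum_filter, Finset.sum_const, nsmul_one, ← Finset.card_powersetCard]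
    congr 2
    ext A
    simp [Finset.mem_powersetCard, and_comm]
  simp_rw [hcount]
  rw [integral_finsetSum _ fun _ _ => .of_finite]
  simp_rw [integral_indicator_one (MeasurableSet.of_discrete (s := {z | _ ⊆ collisions z})),
    measureReal_subset_collisions]
  rw [Finset.sum_congr rfl fun A hA => by rw [(Finset.mem_powersetCard.1 hA).2]]
  simp

end Codes

/-! ### The interference energy as an i.i.d. sum -/

section CharFun

variable {Ns Nh K : ℕ}

theorem norm_exp_ofReal_mul_I_sub_one_le (x : ℝ) : ‖Complex.exp (x * Complex.I) - 1‖ ≤ 2 := by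
  refine (norm_sub_le _ _).trans ?_
  rw [Complex.norm_exp_ofReal_mul_I, norm_one]
  norm_num

theorem norm_exp_relativeCorr_sq_sub_le [NeZero Nh] (t : ℝ) (z : Fin Ns → Fin Nh × Bool) :
    ‖Complex.exp ((relativeCorr z ^ 2 * t : ℝ) * Complex.I) - 1 -
        (collisions z).card * (Complex.exp ((t / Ns ^ 2 : ℝ) * Complex.I) - 1)‖
      ≤ 6 * ((collisions z).card.choose 2 : ℝ) := by
  rcases h : (collisions z).card with _ | _ | n
  · have h0 : relativeCorr z = 0 := by
      rw [relativeCorr, Finset.card_eq_zero.1 h, Finset.sum_empty, zero_div]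
    simp [h0]
  · obtain ⟨m, hm⟩ := Finset.card_eq_one.1 h
    have h1 : relativeCorr z ^ 2 * t = t / Ns ^ 2 := by
      rw [relativeCorr, hm, Finset.sum_singleton, div_pow, pulseSign_sq, one_div_mul_eq_div]
    simp [h1]
  · refine (norm_sub_le _ _).trans ?_
    rw [norm_mul, Complex.norm_natCast, Nat.cast_choose_two]
    have h2 := norm_exp_ofReal_mul_I_sub_one_le (relativeCorr z ^ 2 * t)
    have h3 := mul_le_mul_of_nonneg_left (norm_exp_ofReal_mul_I_sub_one_le (t / Ns ^ 2))
      (Nat.cast_nonneg (α := ℝ) (n + 1 + 1))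
    push_cast at h2 h3 ⊢
    nlinarith [Nat.cast_nonneg (α := ℝ) n]

/-- The characteristic function of the squared cross-correlation of two independent codes,
which does not depend on the first one. -/
def corrCharFun (Ns Nh : ℕ) [NeZero Nh] (t : ℝ) : ℂ :=
  ∫ z, Complex.exp ((relativeCorr z ^ 2 * t : ℝ) * Complex.I) ∂(codeLaw Ns Nh)

theorem norm_corrCharFun_sub_le (Ns Nh : ℕ) [NeZero Nh] (t : ℝ) :
    ‖corrCharFun Ns Nh t - 1 -
        Ns * (Nh : ℂ)⁻¹ * (Complex.exp ((t / Ns ^ 2 : ℝ) * Complex.I) - 1)‖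
      ≤ 6 * (Ns.choose 2 * (Nh : ℝ)⁻¹ ^ 2) := by
  have hmean : ∫ z, ((collisions z).card : ℂ) ∂(codeLaw Ns Nh) = Ns * (Nh : ℂ)⁻¹ := by
    simpa [← integral_complex_ofReal] using
      congrArg Complex.ofReal (integral_choose_card_collisions (Ns := Ns) (Nh := Nh) 1)
  rw [← hmean, ← integral_choose_card_collisions, ← integral_const_mul, ← integral_mul_const]
  have hone : (1 : ℂ) = ∫ _, 1 ∂(codeLaw Ns Nh) := by simp
  nth_rw 1 [hone]
  rw [corrCharFun, ← integral_sub .of_finite .of_finite, ← integral_sub .of_finite .of_finite]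
  exact norm_integral_le_of_norm_le .of_finite
    (ae_of_all _ (norm_exp_relativeCorr_sq_sub_le t))

/-- Replaces the code of every user but `u` by its code relative to user `u`. -/
def relativeCodes (u : Fin K) (c : Fin K → Fin Ns → Fin Nh × Bool) :
    Fin K → Fin Ns → Fin Nh × Bool :=
  fun k => if k = u then c u else relativeCode (c u) (c k)

theorem relativeCodes_injective [NeZero Nh] (u : Fin K) :
    Function.Injective (relativeCodes (Ns := Ns) (Nh := Nh) u) := fun c c' h => by
  have hu : c u = c' u := by simpa [relativeCodes] using congrFun h u
  funext k
  by_cases hk : k = u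
  · rw [hk, hu]
  · refine relativeCode_injective (c u) ?_
    simpa [relativeCodes, hk, ← hu] using congrFun h k

theorem measurePreserving_relativeCodes [NeZero Nh] (u : Fin K) :
    MeasurePreserving (relativeCodes u) (Measure.pi fun _ => codeLaw Ns Nh)
      (Measure.pi fun _ => codeLaw Ns Nh) := by
  simp_rw [codeLaw, pi_uniformOn_univ]
  exact measurePreserving_uniformOn_univ
    (Finite.injective_iff_bijective.1 (relativeCodes_injective u))

theorem interferenceEnergy_thMatrix [NeZero Nh] (c : Fin K → Fin Ns → Fin Nh × Bool)
    (u : Fin K) : interferenceEnergy (thMatrix c) u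
      = ∑ k ∈ Finset.univ.erase u, relativeCorr (relativeCodes u c k) ^ 2 := by
  refine Finset.sum_congr rfl fun k hk => ?_
  rw [crossCorr_thMatrix, relativeCodes, if_neg (Finset.ne_of_mem_erase hk)]

theorem charFun_map_interferenceEnergy [NeZero Nh] (u : Fin K) (t : ℝ) :
    charFun ((thMatrixLaw Ns Nh K).map (fun S => interferenceEnergy S u)) t
      = corrCharFun Ns Nh t ^ (K - 1) := by
  let G (z : Fin Ns → Fin Nh × Bool) : ℂ :=
    Complex.exp ((relativeCorr z ^ 2 * t : ℝ) * Complex.I)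
  have hprod (c : Fin K → Fin Ns → Fin Nh × Bool) :
      Complex.exp ((interferenceEnergy (thMatrix c) u * t : ℝ) * Complex.I)
        = ∏ k, (fun z => if k = u then 1 else G z) (relativeCodes u c k) := by
    rw [interferenceEnergy_thMatrix, Finset.sum_mul, Complex.ofReal_sum, Finset.sum_mul,
      Complex.exp_sum, ← Finset.mul_prod_erase _ _ (Finset.mem_univ u)]
    simp only [if_true, one_mul]
    exact Finset.prod_congr rfl fun k hk => (if_neg (Finset.ne_of_mem_erase hk)).symm
  have hfactor (k : Fin K) : ∫ z, (if k = u then 1 else G z) ∂(codeLaw Ns Nh)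
      = if k = u then 1 else corrCharFun Ns Nh t := by
    split_ifs
    exacts [by simp, rfl]
  have hmeas := measurable_interferenceEnergy (N := Ns * Nh) u
  rw [charFun_apply_real, integral_map hmeas.aemeasurable (by fun_prop),
    thMatrixLaw_eq_map_pi_codeLaw, integral_map Measurable.of_discrete.aemeasurable (by fun_prop)]
  calc ∫ c, Complex.exp (t * interferenceEnergy (thMatrix c) u * Complex.I)
        ∂(Measure.pi fun _ : Fin K => codeLaw Ns Nh)
      = ∫ c, ∏ k, (fun z => if k = u then 1 else G z) (relativeCodes u c k)
          ∂(Measure.pi fun _ => codeLaw Ns Nh) := by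
        refine integral_congr_ae (ae_of_all _ fun c => ?_)
        simp only [← hprod, Complex.ofReal_mul, mul_comm (t : ℂ)]
    _ = ∫ c, ∏ k, (fun z => if k = u then 1 else G z) (c k)
          ∂(Measure.pi fun _ => codeLaw Ns Nh) := by
        conv_rhs => rw [← (measurePreserving_relativeCodes u).map_eq]
        rw [integral_map Measurable.of_discrete.aemeasurable .of_discrete]
    _ = corrCharFun Ns Nh t ^ (K - 1) := by
        rw [integral_fintype_prod_eq_prod (fun k z => if k = u then (1 : ℂ) else G z)]
        simp [hfactor, Finset.prod_ite, Finset.filter_ne']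

end CharFun

/-! ### The Poisson limit of the interference energy -/

section PoissonLimit

theorem tendsto_one_add_pow_exp {ι : Type*} {l : Filter ι} {g : ι → ℂ} {m : ι → ℕ} {z : ℂ}
    (hg : Tendsto g l (𝓝 0)) (hmg : Tendsto (fun j => m j * g j) l (𝓝 z)) :
    Tendsto (fun j => (1 + g j) ^ m j) l (𝓝 (Complex.exp z)) := by
  have hg1 : Tendsto (fun j => 1 + g j) l (𝓝 1) := by simpa using hg.const_add 1
  have hlog : (fun j => Complex.log (1 + g j) - g j) =o[l] g := by
    simpa [Function.comp_def] using
      (Complex.hasDerivAt_log Complex.one_mem_slitPlane).isLittleO.comp_tendsto hg1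
  have hrem : Tendsto (fun j => m j * (Complex.log (1 + g j) - g j)) l (𝓝 0) :=
    (Asymptotics.isLittleO_one_iff ℂ).1 <|
      ((Asymptotics.isBigO_refl (fun j => (m j : ℂ)) l).mul_isLittleO hlog).trans_isBigO
        (hmg.isBigO_one ℂ)
  have hexp := (Complex.continuous_exp.tendsto _).comp (hmg.add hrem)
  rw [add_zero] at hexp
  refine hexp.congr' ?_
  filter_upwards [hg1.eventually_ne one_ne_zero] with j hj
  rw [Function.comp_apply, ← mul_add, add_sub_cancel, Complex.exp_nat_mul, Complex.exp_log hj]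

variable {Ns : ℕ} {Nh K : ℕ → ℕ} [∀ j, NeZero (Nh j)]

theorem tendsto_mul_corrCharFun_sub_one (hNh : Tendsto Nh atTop atTop) (t : ℝ) :
    Tendsto (fun j => (Nh j : ℂ) * (corrCharFun Ns (Nh j) t - 1)) atTop
      (𝓝 (Ns * (Complex.exp ((t / Ns ^ 2 : ℝ) * Complex.I) - 1))) := by
  have hinv : Tendsto (fun j => 6 * (Ns.choose 2 * (Nh j : ℝ)⁻¹)) atTop (𝓝 0) := by
    simpa using ((tendsto_inv_atTop_nhds_zero_nat (𝕜 := ℝ)).comp hNh).const_mul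
      (Ns.choose 2 : ℝ) |>.const_mul 6
  refine tendsto_iff_norm_sub_tendsto_zero.2 (squeeze_zero (fun _ => norm_nonneg _) (fun j => ?_)
    hinv)
  have hR : (Nh j : ℝ) ≠ 0 := NeZero.ne _
  have hC : (Nh j : ℂ) ≠ 0 := NeZero.ne _
  set θ := Complex.exp ((t / Ns ^ 2 : ℝ) * Complex.I) - 1
  calc ‖(Nh j : ℂ) * (corrCharFun Ns (Nh j) t - 1) - Ns * θ‖
      = Nh j * ‖corrCharFun Ns (Nh j) t - 1 - Ns * (Nh j : ℂ)⁻¹ * θ‖ := by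
        rw [← Complex.norm_natCast (Nh j), ← norm_mul]
        congr 1
        field_simp
    _ ≤ Nh j * (6 * (Ns.choose 2 * (Nh j : ℝ)⁻¹ ^ 2)) :=
        mul_le_mul_of_nonneg_left (norm_corrCharFun_sub_le Ns (Nh j) t) (Nat.cast_nonneg _)
    _ = 6 * (Ns.choose 2 * (Nh j : ℝ)⁻¹) := by field_simp

theorem tendsto_interferers_div (hNs : 0 < Ns) {β : ℝ} (hNh : Tendsto Nh atTop atTop)
    (hload : Tendsto (fun j => (K j : ℝ) / ((Ns * Nh j : ℕ) : ℝ)) atTop (𝓝 β))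
    (hK : ∀ j, 0 < K j) :
    Tendsto (fun j => ((K j - 1 : ℕ) : ℝ) / Nh j) atTop (𝓝 (Ns * β)) := by
  have hinv : Tendsto (fun j => (Nh j : ℝ)⁻¹) atTop (𝓝 0) :=
    tendsto_inv_atTop_nhds_zero_nat.comp hNh
  have h := (hload.const_mul (Ns : ℝ)).sub hinv
  rw [sub_zero] at h
  refine h.congr fun j => ?_
  have hR : (Nh j : ℝ) ≠ 0 := NeZero.ne _
  rw [Nat.cast_pred (hK j)]
  push_cast
  field_simp

theorem tendsto_corrCharFun_pow (hNs : 0 < Ns) {β : ℝ} (hNh : Tendsto Nh atTop atTop)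
    (hload : Tendsto (fun j => (K j : ℝ) / ((Ns * Nh j : ℕ) : ℝ)) atTop (𝓝 β))
    (hK : ∀ j, 0 < K j) (t : ℝ) :
    Tendsto (fun j => corrCharFun Ns (Nh j) t ^ (K j - 1)) atTop
      (𝓝 (Complex.exp ((Ns ^ 2 * β : ℝ) *
        (Complex.exp ((t / Ns ^ 2 : ℝ) * Complex.I) - 1)))) := by
  have hC (j : ℕ) : (Nh j : ℂ) ≠ 0 := NeZero.ne _
  have hmul := tendsto_mul_corrCharFun_sub_one (Ns := Ns) hNh t
  have hsub : Tendsto (fun j => corrCharFun Ns (Nh j) t - 1) atTop (𝓝 0) := by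
    have hinv : Tendsto (fun j => (Nh j : ℂ)⁻¹) atTop (𝓝 0) :=
      tendsto_inv_atTop_nhds_zero_nat.comp hNh
    have h := hinv.mul hmul
    rw [zero_mul] at h
    exact h.congr fun j => inv_mul_cancel_left₀ (hC j) _
  have hpow : Tendsto (fun j => ((K j - 1 : ℕ) : ℂ) * (corrCharFun Ns (Nh j) t - 1)) atTop
      (𝓝 ((Ns ^ 2 * β : ℝ) * (Complex.exp ((t / Ns ^ 2 : ℝ) * Complex.I) - 1))) := by
    have h := ((Complex.continuous_ofReal.tendsto _).comp
      (tendsto_interferers_div hNs hNh hload hK)).mul hmul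
    convert h using 1
    · funext j
      rw [Function.comp_apply, Complex.ofReal_div, Complex.ofReal_natCast, Complex.ofReal_natCast,
        div_mul_eq_mul_div, mul_left_comm, mul_div_cancel_left₀ _ (hC j)]
    · push_cast
      ring_nf
  exact (tendsto_one_add_pow_exp hsub hpow).congr fun j => by rw [add_sub_cancel]

theorem charFun_map_div_poissonMeasure (r : ℝ≥0) (a t : ℝ) :
    charFun ((poissonMeasure r).map (fun k : ℕ => (k : ℝ) / a)) t
      = Complex.exp (r * (Complex.exp ((t / a : ℝ) * Complex.I) - 1)) := by
  have h : (poissonMeasure r).map (fun k : ℕ => (k : ℝ) / a)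
      = ((poissonMeasure r).map (Nat.cast : ℕ → ℝ)).map (fun x => a⁻¹ • x) := by
    rw [Measure.map_map (by fun_prop) .of_discrete]
    simp only [Function.comp_def, smul_eq_mul, inv_mul_eq_div]
  rw [h, charFun_map_smul, charFun_map_cast_poissonMeasure]
  simp [div_eq_inv_mul]

theorem tendstoInDistribution_interferenceEnergy (hNs : 0 < Ns) {β : ℝ≥0}
    (hNh : Tendsto Nh atTop atTop)
    (hload : Tendsto (fun j => (K j : ℝ) / ((Ns * Nh j : ℕ) : ℝ)) atTop (𝓝 (β : ℝ)))
    {Ω : ℕ → Type*} [∀ j, MeasurableSpace (Ω j)]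
    {P : ∀ j, Measure (Ω j)} [∀ j, IsProbabilityMeasure (P j)]
    {S : ∀ j, Ω j → Matrix (Fin (Ns * Nh j)) (Fin (K j)) ℝ}
    (hS : ∀ j, HasLaw (S j) (thMatrixLaw Ns (Nh j) (K j)) (P j)) (u : ∀ j, Fin (K j)) :
    TendstoInDistribution (fun j ω => interferenceEnergy (S j ω) (u j)) atTop
      (fun k : ℕ => (k : ℝ) / (Ns : ℝ) ^ 2) P (poissonMeasure ((Ns : ℝ≥0) ^ 2 * β)) := by
  have hmeas (j : ℕ) := measurable_interferenceEnergy (N := Ns * Nh j) (u j)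
  refine ⟨fun j => (hmeas j).comp_aemeasurable (hS j).aemeasurable, .of_discrete, ?_⟩
  refine ProbabilityMeasure.tendsto_of_tendsto_charFun fun t => ?_
  have hchar (j : ℕ) : charFun ((P j).map (fun ω => interferenceEnergy (S j ω) (u j))) t
      = corrCharFun Ns (Nh j) t ^ (K j - 1) := by
    rw [← charFun_map_interferenceEnergy (u j), ← (hS j).map_eq,
      AEMeasurable.map_map_of_aemeasurable (hmeas j).aemeasurable (hS j).aemeasurable]
    rfl
  simp only [ProbabilityMeasure.coe_mk, hchar, charFun_map_div_poissonMeasure]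
  exact_mod_cast tendsto_corrCharFun_pow hNs hNh hload (fun j => (u j).pos) t

end PoissonLimit

/-! ### The rate of a time-hopping system -/

/-- The rate in bits of the scalar Gaussian channel with signal-to-noise ratio `γ` and
interference energy `|x|`. The absolute value makes the rate continuous on the whole line. -/
def rate (γ x : ℝ) : ℝ := Real.logb 2 (1 + γ / (1 + |x| * γ))

theorem continuous_rate {γ : ℝ} (hγ : 0 ≤ γ) : Continuous (rate γ) := by
  unfold rate Real.logb
  refine Continuous.div_const (Continuous.log ?_ fun x => ?_) _
  · exact continuous_const.add (continuous_const.div (by fun_prop) fun x => by positivity)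
  · positivity

theorem rate_nonneg {γ : ℝ} (hγ : 0 ≤ γ) (x : ℝ) : 0 ≤ rate γ x :=
  Real.logb_nonneg (by norm_num) (le_add_of_nonneg_right (by positivity))

theorem norm_rate_le {γ : ℝ} (hγ : 0 ≤ γ) (x : ℝ) : ‖rate γ x‖ ≤ Real.logb 2 (1 + γ) := by
  rw [Real.norm_of_nonneg (rate_nonneg hγ x)]
  refine Real.logb_le_logb_of_le (by norm_num) (by positivity) ?_
  gcongr
  exact div_le_self hγ (le_add_of_nonneg_right (by positivity))

theorem integrable_rate_comp {Ω : Type*} [MeasurableSpace Ω] {P : Measure Ω} [IsFiniteMeasure P]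
    {γ : ℝ} (hγ : 0 ≤ γ) {X : Ω → ℝ} (hX : AEMeasurable X P) :
    Integrable (fun ω => rate γ (X ω)) P :=
  .of_bound ((continuous_rate hγ).measurable.comp_aemeasurable hX).aestronglyMeasurable _
    (ae_of_all _ fun _ => norm_rate_le hγ _)

theorem log_two_mul_rate {E N₀ x : ℝ} (hN₀ : 0 < N₀) (hx : 0 ≤ x) :
    Real.log 2 * rate (E / N₀) x = Real.log (1 + E / (x * E + N₀)) := by
  have hlog : Real.log 2 ≠ 0 := (Real.log_pos one_lt_two).ne'
  rw [rate, abs_of_nonneg hx, Real.logb, mul_div_cancel₀ _ hlog]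
  congr 2
  field_simp
  ring

theorem hasSum_poissonRateTerm (Ns : ℕ) (β : ℝ≥0) {γ : ℝ} (hγ : 0 ≤ γ) :
    HasSum (poissonRateTerm Ns β γ)
      (∫ k : ℕ, rate γ ((k : ℝ) / (Ns : ℝ) ^ 2) ∂(poissonMeasure ((Ns : ℝ≥0) ^ 2 * β))) := by
  refine (funext fun k => ?_ : poissonRateTerm Ns β γ = _) ▸
    hasSum_integral_poissonMeasure (integrable_rate_comp hγ .of_discrete)
  have hk : |(k : ℝ) / (Ns : ℝ) ^ 2| = (k : ℝ) / (Ns : ℝ) ^ 2 := abs_of_nonneg (by positivity)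
  rw [poissonRateTerm, rate, hk, smul_eq_mul]
  push_cast
  rfl

theorem tendsto_integral_comp_of_tendstoInDistribution {ι Ω' 𝓧 : Type*} {Ω : ι → Type*}
    [∀ i, MeasurableSpace (Ω i)] [MeasurableSpace Ω'] [TopologicalSpace 𝓧] [MeasurableSpace 𝓧]
    [OpensMeasurableSpace 𝓧] {μ : ∀ i, Measure (Ω i)} [∀ i, IsProbabilityMeasure (μ i)]
    {ν : Measure Ω'} [IsProbabilityMeasure ν] {X : ∀ i, Ω i → 𝓧} {Z : Ω' → 𝓧} {l : Filter ι}
    (h : TendstoInDistribution X l Z μ ν) {f : 𝓧 → ℝ} (hf : Continuous f) {C : ℝ}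
    (hC : ∀ x, ‖f x‖ ≤ C) :
    Tendsto (fun i => ∫ ω, f (X i ω) ∂(μ i)) l (𝓝 (∫ ω, f (Z ω) ∂ν)) := by
  have hlim := ProbabilityMeasure.tendsto_iff_forall_integral_tendsto.1 h.tendsto
    (.ofNormedAddCommGroup f hf C hC)
  simp only [BoundedContinuousFunction.coe_ofNormedAddCommGroup, ProbabilityMeasure.coe_mk] at hlim
  rw [integral_map h.aemeasurable_limit hf.aestronglyMeasurable] at hlim
  exact hlim.congr fun i => integral_map (h.forall_aemeasurable i) hf.aestronglyMeasurable

section System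

variable {Ω : Type*} [MeasurableSpace Ω] {P : Measure Ω} [IsProbabilityMeasure P] {Ns Nh K : ℕ}
  {E N₀ : ℝ≥0} {S : Ω → Matrix (Fin (Ns * Nh)) (Fin K) ℝ} {b : Ω → Fin K → ℂ}
  {n : Ω → Fin (Ns * Nh) → ℂ}

theorem neZero_of_isGaussianTHSystem (hNs : 0 < Ns) (h : IsGaussianTHSystem P Ns Nh K E N₀ S b n)
    (u : Fin K) : NeZero Nh := by
  refine ⟨?_⟩
  rintro rfl
  have hempty : IsEmpty (Fin K → Fin Ns → Fin 0 × Bool) :=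
    ⟨fun c => (c u ⟨0, hNs⟩).1.elim0⟩
  have hzero : P.map S = 0 := by
    rw [h.law_matrix, thMatrixLaw_eq_map_pi_codeLaw, Measure.eq_zero_of_isEmpty (Measure.pi _),
      Measure.map_zero]
  have := Measure.isProbabilityMeasure_map h.measurable_matrix.aemeasurable (μ := P)
  exact IsProbabilityMeasure.ne_zero _ hzero

theorem ae_crossCorr_self_eq_one [NeZero Nh] (hNs : 0 < Ns) (u : Fin K) :
    ∀ᵐ M ∂(thMatrixLaw Ns Nh K), crossCorr M u u = 1 := by
  rw [thMatrixLaw_eq_map_pi_codeLaw]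
  exact (ae_map_iff Measurable.of_discrete.aemeasurable
    (measurable_crossCorr u u (measurableSet_singleton 1))).2
      (ae_of_all _ fun c => crossCorr_thMatrix_self hNs c u)

theorem sumfMutualInfo_eq [NeZero Nh] (hNs : 0 < Ns) (hN₀ : 0 < N₀)
    (h : IsGaussianTHSystem P Ns Nh K E N₀ S b n) (u : Fin K) :
    sumfMutualInfo P S b n u =
      ENNReal.ofReal (∫ ω, rate ((E : ℝ) / N₀) (interferenceEnergy (S ω) u) ∂P) := by
  have hγ : 0 ≤ (E : ℝ) / N₀ := by positivity
  have hlog : 0 < Real.log 2 := Real.log_pos one_lt_two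
  have henergy := measurable_interferenceEnergy (N := Ns * Nh) u
  have hrate : Measurable fun M : Matrix (Fin (Ns * Nh)) (Fin K) ℝ =>
      ENNReal.ofReal (rate (E / N₀) (interferenceEnergy M u)) :=
    ((continuous_rate hγ).measurable.comp henergy).ennreal_ofReal
  have hb : HasLaw b (Measure.pi fun _ => circularGaussian E) P :=
    ⟨h.measurable_symbols.aemeasurable, h.law_symbols⟩
  have hn : HasLaw n (Measure.pi fun _ => circularGaussian N₀) P :=
    ⟨h.measurable_noise.aemeasurable, h.law_noise⟩
  have hinfo : ∀ᵐ M ∂(P.map S),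
      mutualInfo (fun ω => matchedFilter M u (received M (b ω) (n ω))) (fun ω => b ω u) P =
        ENNReal.ofReal (Real.log 2) * ENNReal.ofReal (rate (E / N₀) (interferenceEnergy M u)) := by
    rw [h.law_matrix]
    filter_upwards [ae_crossCorr_self_eq_one hNs u] with M hM
    rw [mutualInfo_matchedFilter hN₀ hb hn h.indep_symbols_noise hM, ← ENNReal.ofReal_mul hlog.le,
      log_two_mul_rate (mod_cast hN₀) (interferenceEnergy_nonneg M u)]
  have hcond := condMutualInfo_eq_lintegral_mutualInfo h.measurable_matrix
    (h.measurable_symbols.prodMk h.measurable_noise) h.indep_matrix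
    (f := fun M w => matchedFilter M u (received M w.1 w.2)) (g := fun _ w => w.1 u)
    (measurable_matchedFilter_received u) (by fun_prop)
  rw [sumfMutualInfo, hcond, lintegral_congr_ae hinfo, lintegral_const_mul _ hrate,
    mul_div_assoc, ENNReal.mul_div_cancel (by simpa using hlog) ENNReal.ofReal_ne_top,
    lintegral_map hrate h.measurable_matrix]
  exact (ofReal_integral_eq_lintegral_ofReal
    (integrable_rate_comp hγ (henergy.comp h.measurable_matrix).aemeasurable)
    (ae_of_all _ fun _ => rate_nonneg hγ _)).symm

end System

end THCDMA

end

open THCDMA in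
theorem theorem2 (Ns : ℕ) (hNs : 0 < Ns) (β : ℝ≥0) (E N₀ : ℝ≥0) (hE : 0 < E) (hN₀ : 0 < N₀)
    (γ : ℝ) (hγ : γ = (E : ℝ) / (N₀ : ℝ))
    (Nh K : ℕ → ℕ) (hNh : Tendsto Nh atTop atTop)
    (hload : Tendsto (fun j => (K j : ℝ) / ((Ns * Nh j : ℕ) : ℝ)) atTop (𝓝 (β : ℝ)))
    {Ω : ℕ → Type*} [∀ j, MeasurableSpace (Ω j)]
    (P : ∀ j, Measure (Ω j)) [∀ j, IsProbabilityMeasure (P j)]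
    (S : ∀ j, Ω j → Matrix (Fin (Ns * Nh j)) (Fin (K j)) ℝ)
    (b : ∀ j, Ω j → Fin (K j) → ℂ) (n : ∀ j, Ω j → Fin (Ns * Nh j) → ℂ)
    (hsys : ∀ j, THCDMA.IsGaussianTHSystem (P j) Ns (Nh j) (K j) E N₀ (S j) (b j) (n j))
    (u : ∀ j, Fin (K j)) :
    (∀ j, THCDMA.sumfMutualInfo (P j) (S j) (b j) (n j) (u j) ≠ ∞) ∧
    Summable (THCDMA.poissonRateTerm Ns β γ) ∧
    Tendsto (fun j => (THCDMA.sumfMutualInfo (P j) (S j) (b j) (n j) (u j)).toReal) atTop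
      (𝓝 (∑' k, THCDMA.poissonRateTerm Ns β γ k)) ∧
    Tendsto (fun j => (K j : ℝ) / ((Ns * Nh j : ℕ) : ℝ) *
        (THCDMA.sumfMutualInfo (P j) (S j) (b j) (n j) (u j)).toReal) atTop
      (𝓝 ((β : ℝ) * ∑' k, THCDMA.poissonRateTerm Ns β γ k)) ∧
    TendstoInDistribution (fun j ω => THCDMA.interferenceEnergy (S j ω) (u j)) atTop
      (fun k : ℕ => (k : ℝ) / (Ns : ℝ) ^ 2) P (poissonMeasure ((Ns : ℝ≥0) ^ 2 * β)) := by
  have hγ0 : 0 ≤ γ := by rw [hγ]; positivity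
  have hNhne (j : ℕ) : NeZero (Nh j) := neZero_of_isGaussianTHSystem hNs (hsys j) (u j)
  have hS (j : ℕ) : HasLaw (S j) (thMatrixLaw Ns (Nh j) (K j)) (P j) :=
    ⟨(hsys j).measurable_matrix.aemeasurable, (hsys j).law_matrix⟩
  have hdist := tendstoInDistribution_interferenceEnergy hNs hNh hload hS u
  have hinfo (j : ℕ) : sumfMutualInfo (P j) (S j) (b j) (n j) (u j)
      = ENNReal.ofReal (∫ ω, rate γ (interferenceEnergy (S j ω) (u j)) ∂(P j)) :=
    hγ ▸ sumfMutualInfo_eq hNs hN₀ (hsys j) (u j)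
  have hsum := hasSum_poissonRateTerm Ns β hγ0
  have hlim : Tendsto (fun j => (sumfMutualInfo (P j) (S j) (b j) (n j) (u j)).toReal) atTop
      (𝓝 (∑' k, poissonRateTerm Ns β γ k)) := by
    rw [hsum.tsum_eq]
    simp_rw [hinfo, ENNReal.toReal_ofReal (integral_nonneg fun _ => rate_nonneg hγ0 _)]
    exact tendsto_integral_comp_of_tendstoInDistribution hdist (continuous_rate hγ0)
      (norm_rate_le hγ0)
  exact ⟨fun j => hinfo j ▸ ENNReal.ofReal_ne_top, hsum.summable, hlim, hload.mul hlim, hdist⟩
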